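/- Let $\mathbb H^d$ be the real vector space of self-adjoint $d\times d$ complex matrices, with the Frobenius inner product $\langle A,B\rangle=\operatorname{tr}(A^*B)$ and norm $\|A\|_{\mathrm F}=\sqrt{\operatorname{tr}(A^*A)}$, and let $\|\cdot\|$ be the operator norm. For $f:\mathbb R\to\mathbb R$ and $A=V\operatorname{diag}(\lambda_1,\dots,\lambda_d)V^*\in\mathbb H^d$ with $V$ unitary, put $f(A)=V\operatorname{diag}(f(\lambda_1),\dots,f(\lambda_d))V^*$. Define $$\psi(x)=\begin{cases}1/2,&x>1,\\ x-\operatorname{sign}(x)\,x^2/2,&|x|\le 1,\\ -1/2,&x<-1,\end{cases}\qquad \Psi(x)=\begin{cases}\frac{x^2}{2}-\frac{|x|^3}{6},&|x|\le 1,\\ \frac13+\frac12(|x|-1),&|x|>1.\end{cases}$$ Let $m\le n$, let $S$ be a set, $H:S^m\to\mathbb H^d$ a function, $X_1,\dots,X_n\in S$ (for instance a realization of a random sample), and $\theta>0$. Let $I_n^m$ be the set of $m$-tuples of pairwise distinct elements of $\{1,\dots,n\}$, write $H_{i_1\ldots i_m}=H(X_{i_1},\dots,X_{i_m})$, and consider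 the problem $$\text{minimize}\quad \operatorname{tr}\Big[\sum_{(i_1,\ldots,i_m)\in I_n^m}\Psi\big(\theta(H_{i_1\ldots i_m}-U)\big)\Big]\quad\text{over } U\in\mathbb H^d, \tag{P}$$ whose solutions are denoted $\widehat U_n^\star$. Set $$F_\theta(U)=\frac1{\theta^2}\frac{(n-m)!}{n!}\operatorname{tr}\Big[\sum_{(i_1,\ldots,i_m)\in I_n^m}\Psi\big(\theta(H_{i_1\ldots i_m}-U)\big)\Big],\qquad U\in\mathbb H^d.$$ Then: 1. Problem (P) is a convex optimization problem, i.e. its objective is a convex function on $\mathbb H^d$. 2. $F_\theta$ is differentiable on $\mathbb H^d$, and its gradient with respect to the Frobenius inner product is $$\nabla F_\theta(U)=-\frac1\theta\frac{(n-m)!}{n!}\sum_{(i_1,\ldots,i_m)\in I_n^m}\psi\big(\theta(H_{i_1\ldots i_m}-U)\big).$$ Moreover, for all $U,V\in\mathbb H^d$, $\|\nabla F_\theta(U)-\nabla F_\theta(V)\|_{\mathrm F}\le\|U-V\|_{\mathrm F}$ and $\|\nabla F_\theta(U)-\nabla F_\theta(V)\|\le\|U-V\|$. 3. A matrix $\widehat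 U_n^\star\in\mathbb H^d$ is a solution of (P) if and only if $$\sum_{(i_1,\ldots,i_m)\in I_n^m}\psi\big(\theta(H_{i_1\ldots i_m}-\widehat U_n^\star)\big)=0_{d\times d}.$$ -/

import Mathlib

noncomputable section

namespace RobustU

/-- The truncation function `ψ`. -/
def psi (x : ℝ) : ℝ :=
  if 1 < x then 1 / 2
  else if x < -1 then -(1 / 2)
  else x - Real.sign x * x ^ 2 / 2

/-- The loss function `Ψ`. -/
def Psi (x : ℝ) : ℝ :=
  if |x| ≤ 1 then x ^ 2 / 2 - |x| ^ 3 / 6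
  else 1 / 3 + 1 / 2 * (|x| - 1)

/-- The real vector space of self-adjoint `d × d` complex matrices. -/
abbrev Herm (d : ℕ) : Type := selfAdjoint (Matrix (Fin d) (Fin d) ℂ)

/-- The Frobenius norm on self-adjoint matrices. -/
instance instNormedAddCommGroupHerm (d : ℕ) : NormedAddCommGroup (Herm d) :=
  letI : NormedAddCommGroup (Matrix (Fin d) (Fin d) ℂ) := Matrix.frobeniusNormedAddCommGroup
  AddSubgroup.normedAddCommGroup

/-- The Frobenius norm squared is `tr (A* A)`. -/
theorem norm_sq_eq_trace (d : ℕ) (A : Herm d) :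
    ‖A‖ ^ 2 = (Matrix.trace (Matrix.conjTranspose A.1 * A.1)).re := by
  let _ : NormedAddCommGroup (Matrix (Fin d) (Fin d) ℂ) := Matrix.frobeniusNormedAddCommGroup
  have h : ‖A‖ = (∑ i, ∑ j, ‖A.1 i j‖ ^ (2 : ℝ)) ^ (1 / 2 : ℝ) :=
    Matrix.frobenius_norm_def A.1
  rw [h, ← Real.sqrt_eq_rpow, Real.sq_sqrt (by positivity), Finset.sum_comm]
  simp only [Matrix.trace, Matrix.diag, Matrix.mul_apply, Matrix.conjTranspose_apply,
    Complex.re_sum]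
  refine Finset.sum_congr rfl fun i _ => Finset.sum_congr rfl fun j _ => ?_
  simp [Complex.sq_norm, Complex.normSq_apply]

/-- The Frobenius inner product `⟨A, B⟩ = tr (A* B)` on self-adjoint matrices,
on which it is real-valued. -/
instance instInnerProductSpaceHerm (d : ℕ) : InnerProductSpace ℝ (Herm d) :=
  letI : NormedAddCommGroup (Matrix (Fin d) (Fin d) ℂ) := Matrix.frobeniusNormedAddCommGroup
  letI : NormedSpace ℝ (Matrix (Fin d) (Fin d) ℂ) := Matrix.frobeniusNormedSpace
  { norm_smul_le := fun r A => norm_smul_le r A.1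
    inner := fun A B => (Matrix.trace (Matrix.conjTranspose A.1 * B.1)).re
    norm_sq_eq_re_inner := fun A => norm_sq_eq_trace d A
    conj_inner_symm := fun A B => by
      have h : Matrix.conjTranspose A.1 * B.1
          = Matrix.conjTranspose (Matrix.conjTranspose B.1 * A.1) := by
        simp [Matrix.conjTranspose_mul]
      change (Matrix.trace (Matrix.conjTranspose B.1 * A.1)).re
        = (Matrix.trace (Matrix.conjTranspose A.1 * B.1)).re
      rw [h, Matrix.trace_conjTranspose]
      simp
    add_left := fun A B C => by
      simp [Matrix.conjTranspose_add, add_mul, Matrix.trace_add]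
    smul_left := fun A B r => by
      simp [Matrix.conjTranspose_smul, Matrix.trace_smul] }

instance instCompleteSpaceHerm (d : ℕ) :
    @CompleteSpace (Herm d) (instNormedAddCommGroupHerm d).toPseudoMetricSpace.toUniformSpace := by
  have : IsClosed {A : Matrix (Fin d) (Fin d) ℂ | star A = A} :=
    isClosed_eq continuous_star continuous_id
  exact this.isComplete.completeSpace_coe

/-- The operator norm of a self-adjoint matrix acting on Euclidean space. -/
def opNorm {d : ℕ} (A : Herm d) : ℝ :=
  ‖Matrix.toEuclideanCLM (n := Fin d) (𝕜 := ℂ) A.1‖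

/-- The matrix function `f(A) = V f(Λ) V*` for `A = V Λ V*`: Mathlib's functional calculus. -/
def matFun {d : ℕ} (f : ℝ → ℝ) (A : Herm d) : Herm d :=
  ⟨cfc f A.1, cfc_predicate f A.1⟩

/-- The functional calculus is given by diagonalization. -/
theorem matFun_eq {d : ℕ} (f : ℝ → ℝ) (A : Herm d) (hA : A.1.IsHermitian) :
    (matFun f A).1 = (hA.eigenvectorUnitary : Matrix (Fin d) (Fin d) ℂ)
      * Matrix.diagonal (fun i => ((f (hA.eigenvalues i) : ℝ) : ℂ))
      * star (hA.eigenvectorUnitary : Matrix (Fin d) (Fin d) ℂ) :=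
  hA.cfc_eq f

/-- The trace of a self-adjoint matrix, as a real number. -/
def htrace {d : ℕ} (A : Herm d) : ℝ := (Matrix.trace A.1).re

/-- `htrace` is the usual trace. -/
theorem coe_htrace {d : ℕ} (A : Herm d) : ((htrace A : ℝ) : ℂ) = Matrix.trace A.1 := by
  refine Complex.conj_eq_iff_re.mp ?_
  have h : star (Matrix.trace A.1) = Matrix.trace A.1 := by
    rw [← Matrix.trace_conjTranspose]
    exact congrArg Matrix.trace A.2
  exact h

/-- The value `H (x_{i_1}, …, x_{i_m})`; an injective multi-index `(i_1, …, i_m)` is an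
embedding of `Fin m` in `Fin n`. -/
def kernelAt {S : Type*} {m n d : ℕ} (H : (Fin m → S) → Herm d) (x : Fin n → S)
    (i : Fin m ↪ Fin n) : Herm d :=
  H fun j => x (i j)

/-- The objective function of the optimization problem that defines the estimator. -/
def objective {S : Type*} {m n d : ℕ} (H : (Fin m → S) → Herm d) (x : Fin n → S) (θ : ℝ)
    (U : Herm d) : ℝ :=
  htrace (∑ i : Fin m ↪ Fin n, matFun Psi (θ • (kernelAt H x i - U)))

/-- The normalized objective `F_θ`. -/
def F {S : Type*} {m n d : ℕ} (H : (Fin m → S) → Herm d) (x : Fin n → S) (θ : ℝ)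
    (U : Herm d) : ℝ :=
  1 / θ ^ 2 * (((n - m).factorial : ℝ) / (n.factorial : ℝ)) *
    htrace (∑ i : Fin m ↪ Fin n, matFun Psi (θ • (kernelAt H x i - U)))

/-- `U` is a solution of the problem that defines the estimator: a minimizer of the objective
over all self-adjoint matrices. -/
def IsEstimator {S : Type*} {m n d : ℕ} (H : (Fin m → S) → Herm d) (x : Fin n → S) (θ : ℝ)
    (U : Herm d) : Prop :=
  ∀ V : Herm d, objective H x θ U ≤ objective H x θ V

end RobustU

end

/-! The scalar facts are `Psi' = psi` and `psi' = tri`, with `tri` between 0 and 1. Hence `Psi` lies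
above its tangents by at most half the squared distance, and `psi` is nondecreasing and 1-Lipschitz.

Let `A` and `B` have eigenvalues `a_i`, `b_j` and orthonormal eigenvectors `v_i`, `w_j`. Traces of
`f(A)` and `g(B)`, their inner products and squared Frobenius distances are sums over `i, j` with
the same weights `|⟨v_i, w_j⟩|²` of scalar expressions in `a_i, b_j` (`inner_matFun`). Scalar
inequalities therefore pass to matrices term by term. This gives the tangent inequality and the
quadratic upper bound for the objective, and from these convexity, the gradient and the optimality
criterion; it also gives the Frobenius Lipschitz bound.

A scalar Lipschitz bound alone does not control the operator norm. In the two eigenbases, `psi(A) -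
psi(B)` is the Schur product of `A - B` with the divided differences of `psi`, which are averages
over `s` of `tri (s a_i + (1 - s) b_j)`. Since `tri (p + q)` is the overlap of two unit intervals,
one depending on `p` and the other on `q`, it factors as an integral of products of indicators of
mass one. Schur multiplication by it is thus a contraction (`norm_sform_tri_le`), and so is the
average. -/

namespace RobustU

/-! ### Scalar calculus of `psi`, `Psi` and `tri`. -/

section Scalar

theorem hasDerivAt_mul_abs (x : ℝ) : HasDerivAt (fun y : ℝ => y * |y|) (2 * |x|) x := by
  rcases lt_trichotomy x 0 with h | rfl | h
  · have := (hasDerivAt_id x).mul (hasDerivAt_abs_neg h)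
    refine this.congr_deriv ?_
    simp [abs_of_neg h]; ring
  · have : HasDerivAt (fun y : ℝ => y * |y|) (|0|) 0 := by
      rw [hasDerivAt_iff_tendsto_slope]
      have h2 : Filter.Tendsto (fun y : ℝ => |y|) (nhdsWithin 0 {0}ᶜ) (nhds |0|) :=
        continuous_abs.continuousAt.tendsto.mono_left nhdsWithin_le_nhds
      refine h2.congr' ?_
      filter_upwards [self_mem_nhdsWithin] with y hy
      have hy : y ≠ 0 := hy
      simp [slope_def_field, hy]
    simpa using this
  · have := (hasDerivAt_id x).mul (hasDerivAt_abs_pos h)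
    refine this.congr_deriv ?_
    simp [abs_of_pos h]; ring

theorem hasDerivAt_abs_cube (x : ℝ) : HasDerivAt (fun y : ℝ => |y| ^ 3) (3 * (x * |x|)) x := by
  have h := (hasDerivAt_id x).mul (hasDerivAt_mul_abs x)
  have e : (fun y : ℝ => |y| ^ 3) = (id * fun y : ℝ => y * |y|) := by
    funext y
    simp only [Pi.mul_apply, id]
    rw [pow_succ, sq_abs]; ring
  rw [e]
  refine h.congr_deriv ?_
  simp only [id]; ring

/-- A second difference of `x * |x|`: this form has no cases, so it can be differentiated at the
breakpoints `-1, 0, 1` as well. -/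
theorem psi_eq_abs (x : ℝ) :
    psi x = ((x + 1) * |x + 1| + (x - 1) * |x - 1| - 2 * (x * |x|)) / 4 := by
  unfold psi
  split_ifs with h1 h2
  · rw [abs_of_pos (by linarith), abs_of_pos (by linarith), abs_of_pos (by linarith)]; ring
  · rw [abs_of_neg (by linarith), abs_of_neg (by linarith), abs_of_neg (by linarith)]; ring
  · rw [abs_of_nonneg (by linarith : 0 ≤ x + 1), abs_of_nonpos (by linarith : x - 1 ≤ 0)]
    rcases lt_trichotomy x 0 with h | rfl | h
    · rw [Real.sign_of_neg h, abs_of_neg h]; ring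
    · simp
    · rw [Real.sign_of_pos h, abs_of_pos h]; ring

theorem Psi_eq_abs (x : ℝ) :
    Psi x = (|x + 1| ^ 3 + |x - 1| ^ 3 - 2 * |x| ^ 3) / 12 - 1 / 6 := by
  unfold Psi
  split_ifs with h1
  · obtain ⟨h2, h3⟩ := abs_le.1 h1
    rw [abs_of_nonneg (by linarith : 0 ≤ x + 1), abs_of_nonpos (by linarith : x - 1 ≤ 0)]
    ring
  · rcases lt_abs.1 (not_le.1 h1) with h | h
    · rw [abs_of_pos (by linarith), abs_of_pos (by linarith), abs_of_pos (by linarith)]; ring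
    · rw [abs_of_neg (by linarith : x < 0), abs_of_neg (by linarith), abs_of_neg (by linarith)]
      ring

/-- The triangle function, which is the derivative of `psi`. -/
def tri (x : ℝ) : ℝ := max 0 (1 - |x|)

theorem tri_eq_abs (x : ℝ) : tri x = (|x + 1| + |x - 1| - 2 * |x|) / 2 := by
  unfold tri
  rcases abs_cases x with ⟨h, _⟩ | ⟨h, _⟩ <;> rcases abs_cases (x + 1) with ⟨h', _⟩ | ⟨h', _⟩ <;>
    rcases abs_cases (x - 1) with ⟨h'', _⟩ | ⟨h'', _⟩ <;> rw [h, h', h''] <;>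
    rcases max_cases 0 (1 - x) with ⟨g, _⟩ | ⟨g, _⟩ <;>
    rcases max_cases 0 (1 - -x) with ⟨g', _⟩ | ⟨g', _⟩ <;> simp only [g, g'] <;> linarith

theorem tri_nonneg (x : ℝ) : 0 ≤ tri x := le_max_left _ _

theorem tri_le_one (x : ℝ) : tri x ≤ 1 :=
  max_le zero_le_one (by linarith [abs_nonneg x])

theorem continuous_tri : Continuous tri := by
  unfold tri; fun_prop

theorem hasDerivAt_psi (x : ℝ) : HasDerivAt psi (tri x) x := by
  have h1 := (hasDerivAt_mul_abs (x + 1)).comp_add_const x 1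
  have h2 := (hasDerivAt_mul_abs (x - 1)).comp_sub_const x 1
  have h := ((h1.add h2).sub ((hasDerivAt_mul_abs x).const_mul 2)).div_const 4
  rw [funext psi_eq_abs, tri_eq_abs]
  exact h.congr_deriv (by ring)

theorem hasDerivAt_Psi (x : ℝ) : HasDerivAt Psi (psi x) x := by
  have h1 := (hasDerivAt_abs_cube (x + 1)).comp_add_const x 1
  have h2 := (hasDerivAt_abs_cube (x - 1)).comp_sub_const x 1
  have h := (((h1.add h2).sub ((hasDerivAt_abs_cube x).const_mul 2)).div_const 12).sub_const (1 / 6)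
  rw [funext Psi_eq_abs, psi_eq_abs]
  exact h.congr_deriv (by ring)

/-- The divided difference of `psi` is an average of the triangle function. -/
theorem psi_sub_psi (a b : ℝ) :
    psi a - psi b = (a - b) * ∫ s in (0 : ℝ)..1, tri (s * a + (1 - s) * b) := by
  have hd : ∀ s ∈ Set.uIcc (0 : ℝ) 1, HasDerivAt (fun s : ℝ => psi (s * a + (1 - s) * b))
      (tri (s * a + (1 - s) * b) * (a - b)) s := fun s _ => by
    have h1 : HasDerivAt (fun s : ℝ => s * a + (1 - s) * b) (a - b) s := by
      have := ((hasDerivAt_id s).mul_const a).add (((hasDerivAt_id s).const_sub 1).mul_const b)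
      exact this.congr_deriv (by ring)
    exact (hasDerivAt_psi _).comp s h1
  have hc : Continuous fun s : ℝ => tri (s * a + (1 - s) * b) * (a - b) :=
    (continuous_tri.comp (by fun_prop)).mul continuous_const
  have := intervalIntegral.integral_eq_sub_of_hasDerivAt hd (hc.intervalIntegrable 0 1)
  rw [intervalIntegral.integral_mul_const] at this
  simp only [one_mul, sub_self, zero_mul, add_zero, zero_add, sub_zero] at this
  rw [← this, mul_comm]

theorem monotone_psi : Monotone psi :=
  monotone_of_hasDerivAt_nonneg hasDerivAt_psi tri_nonneg

theorem monotone_id_sub_psi : Monotone fun x => x - psi x :=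
  monotone_of_hasDerivAt_nonneg (fun x => (hasDerivAt_id x).sub (hasDerivAt_psi x))
    fun x => sub_nonneg.2 (tri_le_one x)

theorem sq_psi_sub_le (a b : ℝ) : (psi a - psi b) ^ 2 ≤ (a - b) ^ 2 := by
  rcases le_total a b with h | h
  · have h1 := monotone_psi h
    have h2 := monotone_id_sub_psi h
    simp only at h2
    nlinarith
  · have h1 := monotone_psi h
    have h2 := monotone_id_sub_psi h
    simp only at h2
    nlinarith

/-- A function with monotone derivative lies above its tangents. -/
theorem tangent_le_of_monotone_deriv {g g' : ℝ → ℝ} (hg : ∀ x, HasDerivAt g (g' x) x)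
    (hm : Monotone g') (a b : ℝ) : g b + g' b * (a - b) ≤ g a := by
  have hc : Continuous g := continuous_iff_continuousAt.2 fun x => (hg x).continuousAt
  rcases lt_trichotomy a b with h | rfl | h
  · obtain ⟨c, hc', he⟩ := exists_hasDerivAt_eq_slope g g' h hc.continuousOn fun x _ => hg x
    rw [eq_div_iff (by linarith)] at he
    nlinarith [hm hc'.2.le]
  · simp
  · obtain ⟨c, hc', he⟩ := exists_hasDerivAt_eq_slope g g' h hc.continuousOn fun x _ => hg x
    rw [eq_div_iff (by linarith)] at he
    nlinarith [hm hc'.1.le]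

theorem Psi_tangent_le (a b : ℝ) : 0 ≤ Psi a - Psi b - psi b * (a - b) := by
  linarith [tangent_le_of_monotone_deriv hasDerivAt_Psi monotone_psi a b]

theorem Psi_le_quadratic (a b : ℝ) :
    Psi a - Psi b - psi b * (a - b) ≤ (a - b) ^ 2 / 2 := by
  -- The upper bound is the tangent inequality for `x ^ 2 / 2 - Psi x`, whose derivative `x - psi x`
  -- is also monotone.
  have h : ∀ x : ℝ, HasDerivAt (fun x => x ^ 2 / 2 - Psi x) (x - psi x) x := fun x =>
    (((hasDerivAt_pow 2 x).div_const 2).sub (hasDerivAt_Psi x)).congr_deriv (by simp)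
  have := tangent_le_of_monotone_deriv h monotone_id_sub_psi a b
  nlinarith

/-- The triangle function is the autocorrelation of the indicator of `[0, 1]`. -/
theorem integral_indicator_mul_indicator (p q : ℝ) :
    ∫ u : ℝ, (Set.Icc (-p) (1 - p)).indicator (1 : ℝ → ℝ) u *
      (Set.Icc q (1 + q)).indicator (1 : ℝ → ℝ) u = tri (p + q) := by
  have : (fun u : ℝ => (Set.Icc (-p) (1 - p)).indicator (1 : ℝ → ℝ) u *
      (Set.Icc q (1 + q)).indicator (1 : ℝ → ℝ) u) =
      (Set.Icc (max (-p) q) (min (1 - p) (1 + q))).indicator 1 := by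
    rw [← Set.Icc_inter_Icc, Set.inter_indicator_one]; rfl
  rw [this, MeasureTheory.integral_indicator_one measurableSet_Icc, Real.volume_real_Icc, tri,
    max_comm]
  congr 1
  rcases abs_cases (p + q) with ⟨h, _⟩ | ⟨h, _⟩
  · rw [h, max_eq_right (by linarith), min_eq_left (by linarith)]; ring
  · rw [h, max_eq_left (by linarith), min_eq_right (by linarith)]; ring

end Scalar

/-! ### Trace functions and the Frobenius norm in a pair of eigenbases. -/

section Trace

variable {d : ℕ}

/-- The eigenvalues of a self-adjoint matrix. -/
noncomputable def eig (A : Herm d) : Fin d → ℝ :=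
  Matrix.IsHermitian.eigenvalues (A := A.1) A.2

/-- A unitary matrix of eigenvectors of a self-adjoint matrix. -/
noncomputable def eigU (A : Herm d) : Matrix.unitaryGroup (Fin d) ℂ :=
  Matrix.IsHermitian.eigenvectorUnitary (A := A.1) A.2

/-- The change of basis between the eigenvectors of two self-adjoint matrices. -/
noncomputable def transition (A B : Herm d) : Matrix (Fin d) (Fin d) ℂ :=
  star (eigU A : Matrix (Fin d) (Fin d) ℂ) * (eigU B : Matrix (Fin d) (Fin d) ℂ)

theorem coe_matFun (f : ℝ → ℝ) (A : Herm d) :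
    (matFun f A).1 = (eigU A : Matrix (Fin d) (Fin d) ℂ)
      * Matrix.diagonal (fun i => ((f (eig A i) : ℝ) : ℂ))
      * star (eigU A : Matrix (Fin d) (Fin d) ℂ) :=
  matFun_eq f A A.2

theorem matFun_id (A : Herm d) : matFun id A = A :=
  Subtype.ext (cfc_id ℝ A.1 A.2)

theorem matFun_one (A : Herm d) : (matFun (fun _ => 1) A).1 = 1 := by
  simp [coe_matFun]

theorem inner_herm (A B : Herm d) : inner ℝ A B = (Matrix.trace (A.1 * B.1)).re := by
  have h : Matrix.conjTranspose A.1 = A.1 := A.2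
  change (Matrix.trace (Matrix.conjTranspose A.1 * B.1)).re = _
  rw [h]

/-- Cyclicity of the trace gathers the two eigenbases into the single unitary `transition A B`,
whose squared entries are the weights. -/
theorem inner_matFun (f g : ℝ → ℝ) (A B : Herm d) :
    inner ℝ (matFun f A) (matFun g B) =
      ∑ i, ∑ j, Complex.normSq (transition A B i j) * (f (eig A i) * g (eig B j)) := by
  rw [inner_herm, coe_matFun, coe_matFun]
  set V := (eigU A : Matrix (Fin d) (Fin d) ℂ)
  set W := (eigU B : Matrix (Fin d) (Fin d) ℂ)
  set D := Matrix.diagonal (fun i => ((f (eig A i) : ℝ) : ℂ)) with hD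
  set E := Matrix.diagonal (fun i => ((g (eig B i) : ℝ) : ℂ)) with hE
  have h : Matrix.trace (V * D * star V * (W * E * star W)) =
      Matrix.trace ((D * transition A B) * (E * star (transition A B))) := by
    have : (D * transition A B) * (E * star (transition A B)) =
        (D * star V * (W * E * star W)) * V := by
      simp only [transition, star_mul, star_star, V, W, mul_assoc]
    rw [this, Matrix.trace_mul_comm (D * star V * (W * E * star W))]
    simp only [mul_assoc]
  rw [h, Matrix.trace, Complex.re_sum]
  refine Finset.sum_congr rfl fun i _ => ?_
  rw [Matrix.diag_apply, Matrix.mul_apply, Complex.re_sum]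
  refine Finset.sum_congr rfl fun j _ => ?_
  simp only [hD, hE, Matrix.diagonal_mul, Matrix.star_apply]
  have : (f (eig A i) : ℂ) * transition A B i j * (g (eig B j) * star (transition A B i j)) =
      ((Complex.normSq (transition A B i j) * (f (eig A i) * g (eig B j)) : ℝ) : ℂ) := by
    push_cast
    rw [← Complex.mul_conj, starRingEnd_apply]
    ring
  rw [this, Complex.ofReal_re]

/-- The case `g = 1`: `B` enters only so that the trace carries the same weights as the mixed terms
and can be combined with them. -/
theorem htrace_matFun_left (f : ℝ → ℝ) (A B : Herm d) :
    htrace (matFun f A) =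
      ∑ i, ∑ j, Complex.normSq (transition A B i j) * f (eig A i) := by
  have h := inner_matFun f (fun _ => 1) A B
  rw [inner_herm, matFun_one, mul_one] at h
  simpa [htrace] using h

theorem htrace_matFun_right (f : ℝ → ℝ) (A B : Herm d) :
    htrace (matFun f B) =
      ∑ i, ∑ j, Complex.normSq (transition A B i j) * f (eig B j) := by
  have h := inner_matFun (fun _ => 1) f A B
  rw [inner_herm, matFun_one, one_mul] at h
  simpa [htrace] using h

theorem inner_matFun_self (f g : ℝ → ℝ) (A : Herm d) :
    inner ℝ (matFun f A) (matFun g A) = htrace (matFun (fun x => f x * g x) A) := by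
  rw [inner_herm, htrace, coe_matFun, coe_matFun, coe_matFun]
  have hV : star (eigU A : Matrix (Fin d) (Fin d) ℂ) * (eigU A : Matrix (Fin d) (Fin d) ℂ) = 1 :=
    Unitary.coe_star_mul_self _
  set V := (eigU A : Matrix (Fin d) (Fin d) ℂ)
  have h : ∀ D E : Matrix (Fin d) (Fin d) ℂ,
      V * D * star V * (V * E * star V) = V * (D * E) * star V := fun D E => by
    calc _ = V * D * (star V * V) * E * star V := by simp only [mul_assoc]
      _ = _ := by rw [hV]; simp only [mul_assoc, one_mul]
  rw [h, Matrix.diagonal_mul_diagonal]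
  simp

theorem norm_matFun_sub_sq (f : ℝ → ℝ) (A B : Herm d) :
    ‖matFun f A - matFun f B‖ ^ 2 =
      ∑ i, ∑ j, Complex.normSq (transition A B i j) * (f (eig A i) - f (eig B j)) ^ 2 := by
  rw [norm_sub_sq_real, ← real_inner_self_eq_norm_sq, ← real_inner_self_eq_norm_sq,
    inner_matFun_self, inner_matFun_self, inner_matFun, htrace_matFun_left _ A B,
    htrace_matFun_right _ A B]
  simp only [Finset.mul_sum, ← Finset.sum_sub_distrib, ← Finset.sum_add_distrib]
  refine Finset.sum_congr rfl fun i _ => Finset.sum_congr rfl fun j _ => ?_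
  ring

theorem norm_sub_sq_eq_sum (A B : Herm d) :
    ‖A - B‖ ^ 2 =
      ∑ i, ∑ j, Complex.normSq (transition A B i j) * (eig A i - eig B j) ^ 2 := by
  have h := norm_matFun_sub_sq id A B
  rwa [matFun_id, matFun_id] at h

/-- The remainder of the first-order expansion of a trace function, in the eigenbases. -/
theorem htrace_matFun_sub_sub_inner (f g : ℝ → ℝ) (A B : Herm d) :
    htrace (matFun f A) - htrace (matFun f B) - inner ℝ (matFun g B) (A - B) =
      ∑ i, ∑ j, Complex.normSq (transition A B i j) *
        (f (eig A i) - f (eig B j) - g (eig B j) * (eig A i - eig B j)) := by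
  have h1 : inner ℝ (matFun g B) A = inner ℝ (matFun id A) (matFun g B) := by
    rw [real_inner_comm, matFun_id]
  have h2 : inner ℝ (matFun g B) B = inner ℝ (matFun g B) (matFun id B) := by
    rw [matFun_id]
  rw [inner_sub_right, h1, h2, inner_matFun_self, inner_matFun, htrace_matFun_left f A B,
    htrace_matFun_right f A B, htrace_matFun_right _ A B]
  simp only [← Finset.sum_sub_distrib]
  refine Finset.sum_congr rfl fun i _ => Finset.sum_congr rfl fun j _ => ?_
  simp only [id]
  ring

theorem htrace_Psi_tangent_le (A B : Herm d) :
    0 ≤ htrace (matFun Psi A) - htrace (matFun Psi B) - inner ℝ (matFun psi B) (A - B) := by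
  rw [htrace_matFun_sub_sub_inner]
  exact Finset.sum_nonneg fun i _ => Finset.sum_nonneg fun j _ =>
    mul_nonneg (Complex.normSq_nonneg _) (Psi_tangent_le _ _)

theorem htrace_Psi_le_quadratic (A B : Herm d) :
    htrace (matFun Psi A) - htrace (matFun Psi B) - inner ℝ (matFun psi B) (A - B) ≤
      ‖A - B‖ ^ 2 / 2 := by
  rw [htrace_matFun_sub_sub_inner, norm_sub_sq_eq_sum, Finset.sum_div]
  refine Finset.sum_le_sum fun i _ => ?_
  rw [Finset.sum_div]
  refine Finset.sum_le_sum fun j _ => ?_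
  rw [mul_div_assoc]
  exact mul_le_mul_of_nonneg_left (Psi_le_quadratic _ _) (Complex.normSq_nonneg _)

theorem norm_matFun_psi_sub_le (A B : Herm d) :
    ‖matFun psi A - matFun psi B‖ ≤ ‖A - B‖ := by
  refine (sq_le_sq₀ (norm_nonneg _) (norm_nonneg _)).1 ?_
  rw [norm_matFun_sub_sq, norm_sub_sq_eq_sum]
  exact Finset.sum_le_sum fun i _ => Finset.sum_le_sum fun j _ =>
    mul_le_mul_of_nonneg_left (sq_psi_sub_le _ _) (Complex.normSq_nonneg _)

end Trace

/-! ### Schur multipliers and the operator norm. -/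

section Schur

variable {d : ℕ}

/-- The sesquilinear form of a matrix. -/
noncomputable def sform (M : Matrix (Fin d) (Fin d) ℂ) (x y : Fin d → ℂ) : ℂ :=
  ∑ i, ∑ j, star (x i) * M i j * y j

theorem sform_eq_inner (M : Matrix (Fin d) (Fin d) ℂ) (x y : EuclideanSpace ℂ (Fin d)) :
    sform M x y = inner ℂ x (Matrix.toEuclideanCLM (n := Fin d) (𝕜 := ℂ) M y) := by
  rw [PiLp.inner_apply]
  refine Finset.sum_congr rfl fun i _ => ?_
  rw [Matrix.ofLp_toEuclideanCLM, Matrix.mulVec, dotProduct, RCLike.inner_apply, Finset.sum_mul]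
  refine Finset.sum_congr rfl fun j _ => ?_
  rw [starRingEnd_apply]
  ring

/-- Cauchy–Schwarz followed by AM–GM. The arithmetic mean is linear in the squared entries, so the
bound can be integrated over a parameter. -/
theorem norm_sform_le (M : Matrix (Fin d) (Fin d) ℂ) (x y : Fin d → ℂ) :
    ‖sform M x y‖ ≤ ‖Matrix.toEuclideanCLM (n := Fin d) (𝕜 := ℂ) M‖ *
      ((∑ i, ‖x i‖ ^ 2 + ∑ i, ‖y i‖ ^ 2) / 2) := by
  have h := sform_eq_inner M (WithLp.toLp 2 x) (WithLp.toLp 2 y)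
  simp only at h
  rw [h]
  set T := Matrix.toEuclideanCLM (n := Fin d) (𝕜 := ℂ) M
  have hx := EuclideanSpace.norm_sq_eq (WithLp.toLp 2 x)
  have hy := EuclideanSpace.norm_sq_eq (WithLp.toLp 2 y)
  simp only at hx hy
  rw [← hx, ← hy]
  set x' := WithLp.toLp 2 x
  set y' := WithLp.toLp 2 y
  calc ‖inner ℂ x' (T y')‖ ≤ ‖x'‖ * ‖T y'‖ := norm_inner_le_norm _ _
    _ ≤ ‖x'‖ * (‖T‖ * ‖y'‖) := by gcongr; exact T.le_opNorm y'
    _ = ‖T‖ * (‖x'‖ * ‖y'‖) := by ring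
    _ ≤ _ := by gcongr; nlinarith [sq_nonneg (‖x'‖ - ‖y'‖)]

theorem opNorm_le_of_norm_sform_le {M : Matrix (Fin d) (Fin d) ℂ} {c : ℝ} (hc : 0 ≤ c)
    (h : ∀ x y : Fin d → ℂ, ‖sform M x y‖ ≤ c * ((∑ i, ‖x i‖ ^ 2 + ∑ i, ‖y i‖ ^ 2) / 2)) :
    ‖Matrix.toEuclideanCLM (n := Fin d) (𝕜 := ℂ) M‖ ≤ c := by
  refine ContinuousLinearMap.opNorm_le_bound _ hc fun v => ?_
  set T := Matrix.toEuclideanCLM (n := Fin d) (𝕜 := ℂ) M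
  rcases eq_or_ne v 0 with rfl | hv
  · simp
  rcases eq_or_ne (T v) 0 with hTv | hTv
  · rw [hTv, norm_zero]; positivity
  have hv' : 0 < ‖v‖ := norm_pos_iff.2 hv
  have hTv' : 0 < ‖T v‖ := norm_pos_iff.2 hTv
  -- The scaling gives both vectors the norm `‖v‖ * ‖T v‖`, so the arithmetic mean loses nothing.
  have key := h ((‖v‖ : ℂ) • T v) ((‖T v‖ : ℂ) • v)
  have e := sform_eq_inner M ((‖v‖ : ℂ) • T v) ((‖T v‖ : ℂ) • v)
  rw [WithLp.ofLp_smul, WithLp.ofLp_smul] at e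
  rw [e, map_smul, inner_smul_left, inner_smul_right] at key
  have hx := EuclideanSpace.norm_sq_eq ((‖v‖ : ℂ) • T v)
  have hy := EuclideanSpace.norm_sq_eq ((‖T v‖ : ℂ) • v)
  rw [WithLp.ofLp_smul] at hx hy
  rw [← hx, ← hy, norm_smul, norm_smul, norm_mul, norm_mul] at key
  have hin : ‖inner ℂ (T v) (T v)‖ = ‖T v‖ ^ 2 := by
    rw [inner_self_eq_norm_sq_to_K]; simp
  rw [show Matrix.toEuclideanCLM (n := Fin d) (𝕜 := ℂ) M v = T v from rfl, hin] at key
  simp only [RCLike.norm_conj, Complex.norm_real, norm_norm] at key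
  have hpos : 0 < ‖v‖ * ‖T v‖ ^ 2 := by positivity
  refine le_of_mul_le_mul_left ?_ hpos
  nlinarith

theorem integrable_indicator_Icc (a b : ℝ) :
    MeasureTheory.Integrable ((Set.Icc a b).indicator (1 : ℝ → ℝ)) :=
  (MeasureTheory.integrable_indicator_iff measurableSet_Icc).2 continuous_one.integrableOn_Icc

/-- Schur multiplication by the kernel `tri (p i + q j)` does not increase the operator norm. -/
theorem norm_sform_tri_le (M : Matrix (Fin d) (Fin d) ℂ) (p q : Fin d → ℝ) (x y : Fin d → ℂ) :
    ‖sform (Matrix.of fun i j => (tri (p i + q j) : ℂ) * M i j) x y‖ ≤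
      ‖Matrix.toEuclideanCLM (n := Fin d) (𝕜 := ℂ) M‖ *
        ((∑ i, ‖x i‖ ^ 2 + ∑ i, ‖y i‖ ^ 2) / 2) := by
  set c := ‖Matrix.toEuclideanCLM (n := Fin d) (𝕜 := ℂ) M‖
  let a : Fin d → ℝ → ℝ := fun i => (Set.Icc (-p i) (1 - p i)).indicator 1
  let b : Fin d → ℝ → ℝ := fun j => (Set.Icc (q j) (1 + q j)).indicator 1
  have ha : ∀ i, MeasureTheory.Integrable (a i) := fun i => integrable_indicator_Icc _ _
  have hb : ∀ i, MeasureTheory.Integrable (b i) := fun i => integrable_indicator_Icc _ _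
  have hab : ∀ i j, MeasureTheory.Integrable fun u => a i u * b j u := fun i j => by
    have : (fun u => a i u * b j u) =
        (Set.Icc (-p i) (1 - p i) ∩ Set.Icc (q j) (1 + q j)).indicator 1 := by
      rw [Set.inter_indicator_one]; rfl
    rw [this, Set.Icc_inter_Icc]
    exact integrable_indicator_Icc _ _
  have hia : ∀ i, ∫ u, a i u = 1 := fun i => by
    rw [MeasureTheory.integral_indicator_one measurableSet_Icc, Real.volume_real_Icc]; simp
  have hib : ∀ i, ∫ u, b i u = 1 := fun i => by
    rw [MeasureTheory.integral_indicator_one measurableSet_Icc, Real.volume_real_Icc]; simp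
  have ha2 : ∀ i u, a i u ^ 2 = a i u := fun i u => by
    simp only [a, Set.indicator_apply]; split_ifs <;> simp
  have hb2 : ∀ i u, b i u ^ 2 = b i u := fun i u => by
    simp only [b, Set.indicator_apply]; split_ifs <;> simp
  have hrep : sform (Matrix.of fun i j => (tri (p i + q j) : ℂ) * M i j) x y =
      ∫ u : ℝ, sform M (fun i => (a i u : ℂ) * x i) (fun j => (b j u : ℂ) * y j) := by
    have e : ∀ u : ℝ, sform M (fun i => (a i u : ℂ) * x i) (fun j => (b j u : ℂ) * y j) =
        ∑ i, ∑ j, ((a i u * b j u : ℝ) : ℂ) * (star (x i) * M i j * y j) := fun u => by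
      refine Finset.sum_congr rfl fun i _ => Finset.sum_congr rfl fun j _ => ?_
      rw [← starRingEnd_apply, map_mul, Complex.conj_ofReal, starRingEnd_apply]
      push_cast; ring
    simp only [e]
    rw [MeasureTheory.integral_finsetSum _ fun i _ => MeasureTheory.integrable_finsetSum _
      fun j _ => (hab i j).ofReal.mul_const _]
    refine Finset.sum_congr rfl fun i _ => ?_
    rw [MeasureTheory.integral_finsetSum _ fun j _ => (hab i j).ofReal.mul_const _]
    refine Finset.sum_congr rfl fun j _ => ?_
    have hij : ∫ u : ℝ, ((a i u * b j u : ℝ) : ℂ) = (tri (p i + q j) : ℂ) := by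
      rw [← integral_indicator_mul_indicator (p i) (q j)]
      exact integral_ofReal
    rw [MeasureTheory.integral_mul_const, hij, Matrix.of_apply]
    ring
  -- Indicators equal their squares, so the bound is linear in `a i` and `b i`; each of these
  -- integrates to one, which restores the original sums.
  have hbound : ∀ u : ℝ,
      ‖sform M (fun i => (a i u : ℂ) * x i) (fun j => (b j u : ℂ) * y j)‖ ≤
        c * ((∑ i, a i u * ‖x i‖ ^ 2 + ∑ i, b i u * ‖y i‖ ^ 2) / 2) := fun u => by
    refine (norm_sform_le M _ _).trans_eq ?_
    simp only [norm_mul, mul_pow, Complex.norm_real, Real.norm_eq_abs, sq_abs, ha2, hb2, c]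
  have hIa : MeasureTheory.Integrable fun u => ∑ i, a i u * ‖x i‖ ^ 2 :=
    MeasureTheory.integrable_finsetSum _ fun i _ => (ha i).mul_const _
  have hIb : MeasureTheory.Integrable fun u => ∑ i, b i u * ‖y i‖ ^ 2 :=
    MeasureTheory.integrable_finsetSum _ fun i _ => (hb i).mul_const _
  rw [hrep]
  refine (MeasureTheory.norm_integral_le_of_norm_le
    (((hIa.add hIb).div_const 2).const_mul c) (Filter.Eventually.of_forall hbound)).trans_eq ?_
  simp only [Pi.add_apply]
  rw [MeasureTheory.integral_const_mul, MeasureTheory.integral_div,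
    MeasureTheory.integral_add hIa hIb,
    MeasureTheory.integral_finsetSum _ fun i _ => (ha i).mul_const _,
    MeasureTheory.integral_finsetSum _ fun i _ => (hb i).mul_const _]
  simp only [MeasureTheory.integral_mul_const, hia, hib, one_mul]

/-- Schur multiplication by the divided differences of `psi` does not increase the operator
norm. -/
theorem opNorm_schur_divided_difference_le (M : Matrix (Fin d) (Fin d) ℂ) (l r : Fin d → ℝ) :
    ‖Matrix.toEuclideanCLM (n := Fin d) (𝕜 := ℂ) (Matrix.of fun i j =>
      ((∫ s in (0 : ℝ)..1, tri (s * l i + (1 - s) * r j) : ℝ) : ℂ) * M i j)‖ ≤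
      ‖Matrix.toEuclideanCLM (n := Fin d) (𝕜 := ℂ) M‖ := by
  refine opNorm_le_of_norm_sform_le (norm_nonneg _) fun x y => ?_
  have hcont : ∀ i j, Continuous fun s : ℝ =>
      (tri (s * l i + (1 - s) * r j) : ℂ) * (star (x i) * M i j * y j) := fun i j =>
    (Complex.continuous_ofReal.comp (continuous_tri.comp (by fun_prop))).mul continuous_const
  have hrep : sform (Matrix.of fun i j =>
      ((∫ s in (0 : ℝ)..1, tri (s * l i + (1 - s) * r j) : ℝ) : ℂ) * M i j) x y =
      ∫ s in (0 : ℝ)..1, sform (Matrix.of fun i j =>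
        (tri (s * l i + (1 - s) * r j) : ℂ) * M i j) x y := by
    have e : ∀ s : ℝ, sform (Matrix.of fun i j =>
        (tri (s * l i + (1 - s) * r j) : ℂ) * M i j) x y =
        ∑ i, ∑ j, (tri (s * l i + (1 - s) * r j) : ℂ) * (star (x i) * M i j * y j) := fun s => by
      refine Finset.sum_congr rfl fun i _ => Finset.sum_congr rfl fun j _ => ?_
      rw [Matrix.of_apply]; ring
    simp only [e]
    rw [intervalIntegral.integral_finsetSum fun i _ => Continuous.intervalIntegrable
      (continuous_finsetSum _ fun j _ => hcont i j) 0 1]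
    refine Finset.sum_congr rfl fun i _ => ?_
    rw [intervalIntegral.integral_finsetSum fun j _ => (hcont i j).intervalIntegrable 0 1]
    refine Finset.sum_congr rfl fun j _ => ?_
    rw [intervalIntegral.integral_mul_const, intervalIntegral.integral_ofReal, Matrix.of_apply]
    ring
  rw [hrep]
  -- For each `s` the argument splits as `p i + q j`; the bound is uniform in `s` and the interval
  -- has length one.
  refine (intervalIntegral.norm_integral_le_of_norm_le_const fun s _ =>
    norm_sform_tri_le M (fun i => s * l i) (fun j => (1 - s) * r j) x y).trans_eq ?_
  simp

/-- Using a different eigenbasis on each side diagonalizes both terms at once. The cases `f = id`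
and `f = psi` then differ only by the divided differences. -/
theorem star_eigU_mul_sub_mul_eigU (f : ℝ → ℝ) (A B : Herm d) :
    star (eigU A : Matrix (Fin d) (Fin d) ℂ) * (matFun f A - matFun f B).1 *
      (eigU B : Matrix (Fin d) (Fin d) ℂ) =
      Matrix.of fun i j => ((f (eig A i) - f (eig B j) : ℝ) : ℂ) * transition A B i j := by
  have hV : star (eigU A : Matrix (Fin d) (Fin d) ℂ) * (eigU A : Matrix (Fin d) (Fin d) ℂ) = 1 :=
    Unitary.coe_star_mul_self _
  have hW : star (eigU B : Matrix (Fin d) (Fin d) ℂ) * (eigU B : Matrix (Fin d) (Fin d) ℂ) = 1 :=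
    Unitary.coe_star_mul_self _
  rw [AddSubgroup.coe_sub, coe_matFun, coe_matFun]
  have h : ∀ V W D E : Matrix (Fin d) (Fin d) ℂ, star V * V = 1 → star W * W = 1 →
      star V * (V * D * star V - W * E * star W) * W = D * (star V * W) - star V * W * E := by
    intro V W D E hV hW
    calc _ = (star V * V) * D * (star V * W) - star V * W * E * (star W * W) := by
          simp only [mul_sub, sub_mul, mul_assoc]
      _ = _ := by rw [hV, hW, one_mul, mul_one]
  rw [h _ _ _ _ hV hW]
  ext i j
  rw [Matrix.sub_apply, Matrix.diagonal_mul, Matrix.mul_diagonal, Matrix.of_apply]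
  simp only [transition]
  push_cast
  ring

open scoped Matrix.Norms.L2Operator in
theorem norm_star_unitary_mul_mul_unitary (V W : Matrix.unitaryGroup (Fin d) ℂ)
    (M : Matrix (Fin d) (Fin d) ℂ) :
    ‖Matrix.toEuclideanCLM (n := Fin d) (𝕜 := ℂ)
      (star (V : Matrix (Fin d) (Fin d) ℂ) * M * (W : Matrix (Fin d) (Fin d) ℂ))‖ =
      ‖Matrix.toEuclideanCLM (n := Fin d) (𝕜 := ℂ) M‖ := by
  rw [← Matrix.cstar_norm_def, ← Matrix.cstar_norm_def, CStarRing.norm_mul_coe_unitary,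
    ← Unitary.coe_star, CStarRing.norm_coe_unitary_mul]

/-- `psi` is operator Lipschitz with constant one. -/
theorem opNorm_matFun_psi_sub_le (A B : Herm d) :
    opNorm (matFun psi A - matFun psi B) ≤ opNorm (A - B) := by
  unfold opNorm
  have h := star_eigU_mul_sub_mul_eigU id A B
  rw [matFun_id, matFun_id] at h
  rw [← norm_star_unitary_mul_mul_unitary (eigU A) (eigU B),
    ← norm_star_unitary_mul_mul_unitary (eigU A) (eigU B) (A - B).1, h,
    star_eigU_mul_sub_mul_eigU]
  refine le_trans (le_of_eq ?_) (opNorm_schur_divided_difference_le _ (eig A) (eig B))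
  congr 2
  ext i j
  simp only [Matrix.of_apply, id]
  rw [psi_sub_psi]
  push_cast
  ring

end Schur

/-! ### Convexity, gradient and optimality for the objective. -/

section Objective

variable {S : Type*} {m n d : ℕ} (H : (Fin m → S) → Herm d) (x : Fin n → S) (θ : ℝ)

theorem htrace_sum {ι : Type*} (s : Finset ι) (A : ι → Herm d) :
    htrace (∑ i ∈ s, A i) = ∑ i ∈ s, htrace (A i) := by
  simp [htrace, Matrix.trace_sum]

/-- The sum of the truncated deviations, the negative gradient of the objective up to scaling. -/
noncomputable def psiSum (U : Herm d) : Herm d :=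
  ∑ i : Fin m ↪ Fin n, matFun psi (θ • (kernelAt H x i - U))

theorem scaled_sub_scaled (A U V : Herm d) :
    θ • (A - V) - θ • (A - U) = (-θ) • (V - U) := by
  rw [← smul_sub, sub_sub_sub_cancel_left, ← neg_sub V U, smul_neg, neg_smul]

theorem objective_sub_eq_sum (U V : Herm d) :
    objective H x θ V - objective H x θ U + θ * inner ℝ (psiSum H x θ U) (V - U) =
      ∑ i : Fin m ↪ Fin n,
        (htrace (matFun Psi (θ • (kernelAt H x i - V))) -
          htrace (matFun Psi (θ • (kernelAt H x i - U))) -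
          inner ℝ (matFun psi (θ • (kernelAt H x i - U)))
            (θ • (kernelAt H x i - V) - θ • (kernelAt H x i - U))) := by
  simp only [objective, psiSum, htrace_sum, sum_inner, Finset.mul_sum, scaled_sub_scaled,
    inner_smul_right, ← Finset.sum_sub_distrib, ← Finset.sum_add_distrib]
  refine Finset.sum_congr rfl fun i _ => ?_
  ring

theorem objective_tangent_le (U V : Herm d) :
    0 ≤ objective H x θ V - objective H x θ U + θ * inner ℝ (psiSum H x θ U) (V - U) := by
  rw [objective_sub_eq_sum]
  exact Finset.sum_nonneg fun i _ => htrace_Psi_tangent_le _ _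

theorem objective_le_quadratic (U V : Herm d) :
    objective H x θ V - objective H x θ U + θ * inner ℝ (psiSum H x θ U) (V - U) ≤
      Fintype.card (Fin m ↪ Fin n) * (θ ^ 2 * ‖V - U‖ ^ 2 / 2) := by
  rw [objective_sub_eq_sum]
  refine (Finset.sum_le_sum fun i _ => htrace_Psi_le_quadratic _ _).trans_eq ?_
  simp only [scaled_sub_scaled, norm_smul, mul_pow, norm_neg, Real.norm_eq_abs, sq_abs,
    Finset.sum_const, nsmul_eq_mul, Finset.card_univ]

theorem convexOn_objective : ConvexOn ℝ Set.univ (objective H x θ) := by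
  refine ⟨convex_univ, fun U _ V _ a b ha hb hab => ?_⟩
  have h1 := objective_tangent_le H x θ (a • U + b • V) U
  have h2 := objective_tangent_le H x θ (a • U + b • V) V
  set W := a • U + b • V with hW
  -- The linear terms of the tangent inequalities at `W` cancel because `W` is the barycentre of `U`
  -- and `V`.
  have h3 : a * inner ℝ (psiSum H x θ W) (U - W) + b * inner ℝ (psiSum H x θ W) (V - W) = 0 := by
    rw [← inner_smul_right, ← inner_smul_right, ← inner_add_right]
    have : a • (U - W) + b • (V - W) = 0 := by
      have : a • (U - W) + b • (V - W) = (a • U + b • V) - (a + b) • W := by module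
      rw [this, hab, one_smul, ← hW, sub_self]
    rw [this, inner_zero_right]
  simp only [smul_eq_mul]
  have h4 : (a + b) * objective H x θ W = objective H x θ W := by rw [hab, one_mul]
  linear_combination mul_nonneg ha h1 + mul_nonneg hb h2 + θ * h3 - h4

theorem hasGradientAt_of_quadratic_bound {E : Type*} [NormedAddCommGroup E]
    [InnerProductSpace ℝ E] [CompleteSpace E] {f : E → ℝ} {g u : E} {C : ℝ}
    (h : ∀ v, |f v - f u - inner ℝ g (v - u)| ≤ C * ‖v - u‖ ^ 2) : HasGradientAt f g u := by
  rw [hasGradientAt_iff_isLittleO]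
  have h1 : (fun v => f v - f u - inner ℝ g (v - u)) =O[nhds u] fun v => ‖v - u‖ ^ 2 :=
    Asymptotics.IsBigO.of_bound C (Filter.Eventually.of_forall fun v => by
      simpa using h v)
  refine h1.trans_isLittleO ?_
  have h2 : (fun v : E => v - u) =o[nhds u] fun _ => (1 : ℝ) :=
    (Asymptotics.isLittleO_one_iff ℝ).2 (by
      have : Filter.Tendsto (fun v : E => v - u) (nhds u) (nhds (u - u)) :=
        (continuous_id.sub continuous_const).tendsto u
      simpa using this)
  have h3 := h2.norm_left.mul_isBigO (Asymptotics.isBigO_refl (fun v : E => ‖v - u‖) (nhds u))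
  simp only [one_mul, ← pow_two] at h3
  exact h3.norm_right.trans_isBigO (by simpa using Asymptotics.isBigO_refl _ _)

theorem hasGradientAt_objective (U : Herm d) :
    HasGradientAt (objective H x θ) (-(θ • psiSum H x θ U)) U := by
  refine hasGradientAt_of_quadratic_bound
    (C := Fintype.card (Fin m ↪ Fin n) * (θ ^ 2 / 2)) fun V => ?_
  have h1 := objective_tangent_le H x θ U V
  have h2 := objective_le_quadratic H x θ U V
  rw [inner_neg_left, real_inner_smul_left, sub_neg_eq_add, abs_of_nonneg h1]
  exact h2.trans_eq (by ring)

theorem hasGradientAt_F (hθ : θ ≠ 0) (U : Herm d) :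
    HasGradientAt (F H x θ)
      (-((1 / θ * (((n - m).factorial : ℝ) / (n.factorial : ℝ))) • psiSum H x θ U)) U := by
  have h := (hasGradientAt_objective H x θ U).hasFDerivAt.const_mul
    (1 / θ ^ 2 * (((n - m).factorial : ℝ) / (n.factorial : ℝ)))
  rw [hasGradientAt_iff_hasFDerivAt]
  refine h.congr_fderiv ?_
  rw [← map_smul, smul_neg, smul_smul]
  congr 3
  field_simp

/-- Fermat's rule gives necessity; the tangent inequality at a critical point gives global
minimality. -/
theorem isEstimator_iff (hθ : 0 < θ) (U : Herm d) :
    IsEstimator H x θ U ↔ psiSum H x θ U = 0 := by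
  constructor
  · intro h
    have hmin : IsLocalMin (objective H x θ) U := Filter.Eventually.of_forall h
    have h0 := hmin.hasFDerivAt_eq_zero (hasGradientAt_objective H x θ U).hasFDerivAt
    rw [map_eq_zero_iff _ (LinearIsometryEquiv.injective _), neg_eq_zero, smul_eq_zero] at h0
    exact h0.resolve_left hθ.ne'
  · intro h V
    have := objective_tangent_le H x θ U V
    rw [h, inner_zero_left] at this
    linarith

/-- This normalization, together with the cancellation of `θ`, makes the Lipschitz constant of the
gradient equal to one. -/
theorem card_embedding_mul_factorial (hmn : m ≤ n) :
    ((n - m).factorial : ℝ) / (n.factorial : ℝ) * Fintype.card (Fin m ↪ Fin n) = 1 := by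
  have h : Fintype.card (Fin m ↪ Fin n) = n.descFactorial m := by
    rw [Fintype.card_embedding_eq, Fintype.card_fin, Fintype.card_fin]
  rw [h, div_mul_eq_mul_div, div_eq_one_iff_eq (by positivity)]
  exact_mod_cast Nat.factorial_mul_descFactorial hmn

theorem gradient_F_sub (hθ : θ ≠ 0) (U V : Herm d) :
    gradient (F H x θ) U - gradient (F H x θ) V =
      (-(1 / θ * (((n - m).factorial : ℝ) / (n.factorial : ℝ)))) •
        ∑ i : Fin m ↪ Fin n, (matFun psi (θ • (kernelAt H x i - U)) -
          matFun psi (θ • (kernelAt H x i - V))) := by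
  rw [(hasGradientAt_F H x θ hθ U).gradient, (hasGradientAt_F H x θ hθ V).gradient,
    Finset.sum_sub_distrib, psiSum, psiSum]
  module

/-- A seminorm that `psi` does not increase is not increased by the gradient of `F`. -/
theorem seminorm_gradient_F_sub_le (N : Seminorm ℝ (Herm d))
    (hN : ∀ A B : Herm d, N (matFun psi A - matFun psi B) ≤ N (A - B))
    (hmn : m ≤ n) (hθ : 0 < θ) (U V : Herm d) :
    N (gradient (F H x θ) U - gradient (F H x θ) V) ≤ N (U - V) := by
  have hsum : N (∑ i : Fin m ↪ Fin n, (matFun psi (θ • (kernelAt H x i - U)) -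
      matFun psi (θ • (kernelAt H x i - V)))) ≤
      Fintype.card (Fin m ↪ Fin n) * (θ * N (U - V)) := by
    refine (Finset.le_sum_of_subadditive N (map_zero N).le (map_add_le_add N) _ _).trans ?_
    refine (Finset.sum_le_sum fun i _ => hN _ _).trans_eq ?_
    simp only [scaled_sub_scaled, map_smul_eq_mul, Real.norm_eq_abs, abs_neg, abs_of_pos hθ,
      Finset.sum_const, nsmul_eq_mul, Finset.card_univ]
  have hc := card_embedding_mul_factorial hmn
  rw [gradient_F_sub H x θ hθ.ne', map_smul_eq_mul, norm_neg, Real.norm_of_nonneg (by positivity)]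
  refine (mul_le_mul_of_nonneg_left hsum (by positivity)).trans_eq ?_
  calc _ = (((n - m).factorial : ℝ) / (n.factorial : ℝ) * Fintype.card (Fin m ↪ Fin n)) *
        (1 / θ * θ) * N (U - V) := by ring
    _ = _ := by rw [hc, one_div_mul_cancel hθ.ne', one_mul, one_mul]

/-- The operator norm, as a seminorm. -/
noncomputable def opSeminorm (d : ℕ) : Seminorm ℝ (Herm d) :=
  Seminorm.of opNorm
    (fun A B => by
      simp only [opNorm, AddSubgroup.coe_add, map_add]
      exact norm_add_le _ _)
    (fun r A => by
      have : (r • A).1 = (r : ℂ) • A.1 := by ext; simp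
      simp only [opNorm, this, map_smul, norm_smul, Complex.norm_real])

end Objective

end RobustU

theorem mainTheorem8 {S : Type*} (m n d : ℕ) (hmn : m ≤ n)
    (H : (Fin m → S) → RobustU.Herm d) (x : Fin n → S) (θ : ℝ) (hθ : 0 < θ) :
    ConvexOn ℝ Set.univ (RobustU.objective H x θ) ∧
    (∀ U : RobustU.Herm d,
      HasGradientAt (RobustU.F H x θ)
        (-((1 / θ * (((n - m).factorial : ℝ) / (n.factorial : ℝ))) •
          ∑ i : Fin m ↪ Fin n,
            RobustU.matFun RobustU.psi (θ • (RobustU.kernelAt H x i - U)))) U) ∧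
    (∀ U V : RobustU.Herm d,
      ‖gradient (RobustU.F H x θ) U - gradient (RobustU.F H x θ) V‖ ≤ ‖U - V‖) ∧
    (∀ U V : RobustU.Herm d,
      RobustU.opNorm (gradient (RobustU.F H x θ) U - gradient (RobustU.F H x θ) V)
        ≤ RobustU.opNorm (U - V)) ∧
    (∀ U : RobustU.Herm d,
      RobustU.IsEstimator H x θ U ↔
        ∑ i : Fin m ↪ Fin n,
          RobustU.matFun RobustU.psi (θ • (RobustU.kernelAt H x i - U)) = 0) :=
  ⟨RobustU.convexOn_objective H x θ,
    RobustU.hasGradientAt_F H x θ hθ.ne',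
    RobustU.seminorm_gradient_F_sub_le H x θ (normSeminorm ℝ _) RobustU.norm_matFun_psi_sub_le
      hmn hθ,
    RobustU.seminorm_gradient_F_sub_le H x θ (RobustU.opSeminorm d)
      RobustU.opNorm_matFun_psi_sub_le hmn hθ,
    RobustU.isEstimator_iff H x θ hθ⟩
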